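/- Let $m\ge 1$, let $V=(v_1,\dots,v_m)$ be a family of points of $\mathbb{R}^d$, let $r\in\mathbb{R}^d$, and let $k=\dim\operatorname{conv}(V)$ (the rank of the pair $(V,r)$). Let $\mathcal{K}(V,r)$ be the abstract simplicial complex whose simplices are the sets $I\subset\{1,\dots,m\}$ with $r\notin\operatorname{conv}\{v_i : i\in I\}$, and let $|\mathcal{K}(V,r)|$ be its geometric realization. 1. If $r$ lies in the relative interior of $\operatorname{conv}(V)$, then $|\mathcal{K}(V,r)|$ is homotopy equivalent to the unit sphere $S^{k-1}\subset\mathbb{R}^k$ (where $S^{-1}=\emptyset$). 2. If $r$ does not lie in the relative interior of $\operatorname{conv}(V)$, then $|\mathcal{K}(V,r)|$ is contractible. Moreover, there is a nonempty set $T\subset\{1,\dots,m\}$ such that $\mathcal{K}(V,r)$ is the join of its subcomplex induced on $\{1,\dots,m\}\setminus T$ with the full simplex on $T$; in particular it is a cone with apex any vertex in $T$. -/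

import Mathlib

namespace BalancedPairs

/-- The dimension `rk(V)` of the polytope `conv(V)`, where `V` is the family of points `v`. -/
noncomputable def rk {d : ℕ} {ι : Type*} (v : ι → EuclideanSpace ℝ (Fin d)) : ℕ :=
  Module.finrank ℝ (vectorSpan ℝ (convexHull ℝ (Set.range v)))

/-- A set of indices `I` is `r`-balanced if `r ∈ conv {v i | i ∈ I}`. -/
def IsBalanced {d : ℕ} {ι : Type*} (v : ι → EuclideanSpace ℝ (Fin d))
    (r : EuclideanSpace ℝ (Fin d)) (I : Finset ι) : Prop :=
  r ∈ convexHull ℝ (v '' (I : Set ι))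

/-- The complex `K(V, r)` of non-`r`-balanced sets of indices. As usual in Mathlib, the empty
simplex is left implicit. An index `i` with `v i = r` spans no simplex. -/
def nonBalancedComplex {d : ℕ} {ι : Type*} (v : ι → EuclideanSpace ℝ (Fin d))
    (r : EuclideanSpace ℝ (Fin d)) : PreAbstractSimplicialComplex ι where
  faces := {I | I.Nonempty ∧ ¬ IsBalanced v r I}
  isRelLowerSet_faces := fun _ hs =>
    ⟨hs.1, fun _ hts ht => ⟨ht, fun hr => hs.2
      (convexHull_mono (Set.image_mono (Finset.coe_subset.mpr hts)) hr)⟩⟩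

/-- The geometric realization `|K|` of a simplicial complex with finitely many vertices, in
barycentric coordinates: the union of the faces of the standard simplex that are spanned by the
simplices of `K`, with the subspace topology from `ι → ℝ`. -/
def realization {ι : Type*} [Fintype ι] (K : PreAbstractSimplicialComplex ι) : Set (ι → ℝ) :=
  {x | x ∈ stdSimplex ℝ ι ∧ ∃ s ∈ K.faces, Function.support x ⊆ (s : Set ι)}

/-- The subcomplex of `K` induced on the vertices in `A`. -/
def induced {ι : Type*} (K : PreAbstractSimplicialComplex ι) (A : Finset ι) :
    PreAbstractSimplicialComplex ι where
  faces := {s | s ∈ K.faces ∧ s ⊆ A}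
  isRelLowerSet_faces := fun _ hs =>
    ⟨(K.isRelLowerSet_faces hs.1).1, fun _ hts ht =>
      ⟨(K.isRelLowerSet_faces hs.1).2 hts ht, hts.trans hs.2⟩⟩

/-- The full simplex on the vertices in `A`. -/
def fullSimplex {ι : Type*} (A : Finset ι) : PreAbstractSimplicialComplex ι where
  faces := {s | s.Nonempty ∧ s ⊆ A}
  isRelLowerSet_faces := fun _ hs => ⟨hs.1, fun _ hts ht => ⟨ht, hts.trans hs.2⟩⟩

/-- The join `K * L` of two complexes (used for complexes without common vertices): its simplices
are the nonempty unions `a ∪ b`, where `a` is empty or a simplex of `K`, and `b` is empty or a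
simplex of `L`. -/
def join {ι : Type*} [DecidableEq ι] (K L : PreAbstractSimplicialComplex ι) :
    PreAbstractSimplicialComplex ι where
  faces := {s | s.Nonempty ∧ ∃ a b : Finset ι,
    (a = ∅ ∨ a ∈ K.faces) ∧ (b = ∅ ∨ b ∈ L.faces) ∧ s = a ∪ b}
  isRelLowerSet_faces := by
    have key : ∀ (M : PreAbstractSimplicialComplex ι) (a t : Finset ι),
        (a = ∅ ∨ a ∈ M.faces) → (t ∩ a = ∅ ∨ t ∩ a ∈ M.faces) := by
      intro M a t ha
      rcases (t ∩ a).eq_empty_or_nonempty with h | h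
      · exact Or.inl h
      · rcases ha with rfl | ha
        · simp at h
        · exact Or.inr ((M.isRelLowerSet_faces ha).2 Finset.inter_subset_right h)
    rintro s ⟨hs, a, b, ha, hb, rfl⟩
    refine ⟨hs, fun t hts ht => ⟨ht, t ∩ a, t ∩ b, key K a t ha, key L b t hb, ?_⟩⟩
    rw [← Finset.inter_union_distrib_left]
    exact (Finset.inter_eq_left.mpr hts).symm

end BalancedPairs

/-!
After an affine isometry it may be assumed that `r = 0` and that the points `w i` affinely span
`ℝᵏ`; if `r` is not even in the affine span of the points, then no set is balanced and the complex
is a full simplex.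

If `0` is interior to `conv(w)`, every `u ≠ 0` satisfies `⟪u, w i⟫ > 0` for some `i`, and the set
`P u` of all such `i` is a simplex of `K(w, 0)`, since a half-space separates it from `0`. This
gives explicit maps between the sphere and the realization: `φ` sends `u` to the normalization of
the weights `max ⟪u, w i⟫ 0`, and `ψ` sends the weights `x` to the normalization of
`L x = ∑ i, x i • w i`, which is nonzero because the support of `x` is not balanced. Now
`⟪L (φ u), u⟫ > 0`, so `ψ ∘ φ` is homotopic to the identity by `homotopic_of_inner_pos`. For the
other composite, `⟪L x, L x⟫ > 0` shows that the support of `x` meets `P (L x)`. So the weights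
`x i * max ⟪L x, w i⟫ 0` can be normalized, and they are joined by segments within simplices both to
`x` and to `φ (ψ x)`; `homotopic_of_common_simplex` applies twice. This is carried out in
`nonempty_homotopyEquiv_sphere`.

If `0` is not interior to `conv(w)`, a hyperplane through `0` supports `conv(w)` without containing
it. The vertices off the hyperplane form the set `T`: a convex combination of the `w i` equal to `0`
uses none of them (`isBalanced_sdiff_of_nonneg`). Hence adding or removing elements of `T` does not
affect whether a set is balanced, so the complex is the join with the simplex on `T`, and its
realization is star-shaped about any vertex in `T`.
-/

open scoped InnerProductSpace

namespace BalancedPairs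

/-! ### Balanced sets and barycentric coordinates -/

theorem isBalanced_iff {d : ℕ} {ι : Type*} [Fintype ι] {v : ι → EuclideanSpace ℝ (Fin d)}
    {r : EuclideanSpace ℝ (Fin d)} {I : Finset ι} :
    IsBalanced v r I ↔
      ∃ x ∈ stdSimplex ℝ ι, Function.support x ⊆ (I : Set ι) ∧ ∑ i, x i • v i = r := by
  classical
  constructor
  · intro h
    have hconv : Convex ℝ {x : ι → ℝ | x ∈ stdSimplex ℝ ι ∧ Function.support x ⊆ (I : Set ι)} := by
      rintro x ⟨hx, hxI⟩ y ⟨hy, hyI⟩ a b ha hb hab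
      refine ⟨convex_stdSimplex ℝ ι hx hy ha hb hab, fun i hi => ?_⟩
      by_contra hiI
      have h1 : x i = 0 := Function.notMem_support.1 fun h => hiI (hxI h)
      have h2 : y i = 0 := Function.notMem_support.1 fun h => hiI (hyI h)
      exact hi (by simp [h1, h2])
    have hsub : v '' (I : Set ι) ⊆ (Fintype.linearCombination ℝ v) ''
        {x : ι → ℝ | x ∈ stdSimplex ℝ ι ∧ Function.support x ⊆ (I : Set ι)} := by
      rintro _ ⟨i, hi, rfl⟩
      refine ⟨Pi.single i 1, ⟨single_mem_stdSimplex ℝ i, ?_⟩, ?_⟩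
      · exact Pi.support_single_subset.trans (by simpa using hi)
      · simp [Fintype.linearCombination_apply_single]
    obtain ⟨x, ⟨hx, hxI⟩, hxr⟩ := convexHull_min hsub (hconv.linear_image _) h
    exact ⟨x, hx, hxI, by simpa [Fintype.linearCombination_apply] using hxr⟩
  · rintro ⟨x, hx, hxI, rfl⟩
    have h0 : ∀ i ∉ I, x i = 0 := fun i hi => Function.notMem_support.1 fun h => hi (hxI h)
    have h1 : ∑ i ∈ I, x i = 1 := by
      rw [← hx.2]
      exact Finset.sum_subset (Finset.subset_univ _) fun i _ hi => h0 i hi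
    have h2 : ∑ i, x i • v i = ∑ i ∈ I, x i • v i :=
      (Finset.sum_subset (Finset.subset_univ _) fun i _ hi => by simp [h0 i hi]).symm
    rw [IsBalanced, h2]
    exact (convex_convexHull ℝ _).sum_mem (fun i _ => hx.1 i) h1
      fun i hi => subset_convexHull ℝ _ (Set.mem_image_of_mem v hi)

theorem not_isBalanced_empty {d : ℕ} {ι : Type*} (v : ι → EuclideanSpace ℝ (Fin d))
    (r : EuclideanSpace ℝ (Fin d)) : ¬ IsBalanced v r ∅ := by
  simp [IsBalanced]

/-- The vertices strictly on one side of a hyperplane through the origin span a simplex. -/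
theorem mem_faces_of_inner_pos {d : ℕ} {ι : Type*} {w : ι → EuclideanSpace ℝ (Fin d)}
    {u : EuclideanSpace ℝ (Fin d)} {I : Finset ι} (hI : I.Nonempty)
    (hu : ∀ i ∈ I, 0 < ⟪u, w i⟫_ℝ) : I ∈ (nonBalancedComplex w 0).faces := by
  refine ⟨hI, fun h => ?_⟩
  have hsub : convexHull ℝ (w '' (I : Set ι)) ⊆ {y | 0 < innerSL ℝ u y} :=
    convexHull_min (by rintro _ ⟨i, hi, rfl⟩; exact hu i hi)
      (convex_halfSpace_gt (innerSL ℝ u).toLinearMap.isLinear 0)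
  simpa using hsub h

/-! ### Straight-line homotopies -/

/-- Two maps into a realization are homotopic if their values at each point lie in a common
closed simplex. -/
theorem homotopic_of_common_simplex {X ι : Type*} [TopologicalSpace X] [Fintype ι]
    {K : PreAbstractSimplicialComplex ι} (f g : C(X, realization K))
    (h : ∀ x, ∃ s ∈ K.faces, Function.support (f x : ι → ℝ) ⊆ (s : Set ι) ∧
      Function.support (g x : ι → ℝ) ⊆ (s : Set ι)) : f.Homotopic g := by
  refine ⟨⟨⟨fun p => ⟨(1 - (p.1 : ℝ)) • (f p.2 : ι → ℝ) + (p.1 : ℝ) • (g p.2 : ι → ℝ), ?_⟩, ?_⟩,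
    fun x => ?_, fun x => ?_⟩⟩
  · obtain ⟨s, hs, hf, hg⟩ := h p.2
    refine ⟨convex_stdSimplex ℝ ι (f p.2).2.1 (g p.2).2.1 (sub_nonneg.2 p.1.2.2) p.1.2.1
      (by ring), s, hs, fun i hi => ?_⟩
    by_contra his
    have h1 : (f p.2 : ι → ℝ) i = 0 := Function.notMem_support.1 fun h => his (hf h)
    have h2 : (g p.2 : ι → ℝ) i = 0 := Function.notMem_support.1 fun h => his (hg h)
    exact hi (by simp [h1, h2])
  · fun_prop
  · ext1; simp
  · ext1; simp

/-- Two maps into a sphere are homotopic if their values at each point span an acute angle. -/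
theorem homotopic_of_inner_pos {X F : Type*} [TopologicalSpace X] [NormedAddCommGroup F]
    [InnerProductSpace ℝ F] (f g : C(X, Metric.sphere (0 : F) 1))
    (h : ∀ x, 0 < ⟪(f x : F), (g x : F)⟫_ℝ) : f.Homotopic g := by
  have hne : ∀ p : unitInterval × X,
      (1 - (p.1 : ℝ)) • (f p.2 : F) + (p.1 : ℝ) • (g p.2 : F) ≠ 0 := by
    intro p h0
    have hinner := congrArg (fun y => ⟪y, (g p.2 : F)⟫_ℝ) h0
    have hg : ‖(g p.2 : F)‖ = 1 := by simp
    simp only [inner_add_left, real_inner_smul_left, inner_zero_left,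
      real_inner_self_eq_norm_sq, hg] at hinner
    have hp0 := p.1.2.1
    have hp1 := p.1.2.2
    rcases hp0.eq_or_lt with hp | hp
    · rw [← hp] at hinner
      linarith [h p.2]
    · nlinarith [mul_nonneg (sub_nonneg.2 hp1) (h p.2).le]
  refine ⟨⟨⟨fun p => ⟨‖(1 - (p.1 : ℝ)) • (f p.2 : F) + (p.1 : ℝ) • (g p.2 : F)‖⁻¹ •
    ((1 - (p.1 : ℝ)) • (f p.2 : F) + (p.1 : ℝ) • (g p.2 : F)), ?_⟩, ?_⟩, fun x => ?_, fun x => ?_⟩⟩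
  · rw [mem_sphere_zero_iff_norm, norm_smul, norm_inv, norm_norm,
      inv_mul_cancel₀ (norm_ne_zero_iff.2 (hne p))]
  · refine Continuous.subtype_mk (Continuous.smul (Continuous.inv₀ (by fun_prop)
      fun p => norm_ne_zero_iff.2 (hne p)) (by fun_prop)) _
  · ext1; simp
  · ext1; simp

/-! ### The homotopy equivalence with the sphere -/

theorem inv_sum_smul_mem_stdSimplex {ι : Type*} [Fintype ι] {y : ι → ℝ} (hy : ∀ i, 0 ≤ y i)
    (hpos : 0 < ∑ i, y i) : (∑ i, y i)⁻¹ • y ∈ stdSimplex ℝ ι :=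
  ⟨fun i => mul_nonneg (inv_nonneg.2 hpos.le) (hy i), by
    simp only [Pi.smul_apply, smul_eq_mul]
    rw [← Finset.mul_sum, inv_mul_cancel₀ hpos.ne']⟩

/-- If no closed half-space `{y | ⟪u, y⟫ ≤ 0}` with `u ≠ 0` contains all `w i`, then `K(w, 0)` is
homotopy equivalent to the unit sphere. -/
theorem nonempty_homotopyEquiv_sphere {k : ℕ} {ι : Type*} [Fintype ι]
    (w : ι → EuclideanSpace ℝ (Fin k)) (hw : ∀ u ≠ 0, ∃ i, 0 < ⟪u, w i⟫_ℝ) :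
    Nonempty (ContinuousMap.HomotopyEquiv (realization (nonBalancedComplex w 0))
      (Metric.sphere (0 : EuclideanSpace ℝ (Fin k)) 1)) := by
  classical
  set K := nonBalancedComplex w 0
  set S := Metric.sphere (0 : EuclideanSpace ℝ (Fin k)) 1
  let L : (ι → ℝ) → EuclideanSpace ℝ (Fin k) := fun x => ∑ i, x i • w i
  have hLc : Continuous L := by fun_prop
  have hL : ∀ x : realization K, L x ≠ 0 := by
    rintro ⟨x, hx, s, hs, hxs⟩ h0
    exact hs.2 (isBalanced_iff.2 ⟨x, hx, hxs, h0⟩)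
  let P : EuclideanSpace ℝ (Fin k) → Finset ι := fun u => {i | 0 < ⟪u, w i⟫_ℝ}
  have hP : ∀ u ≠ 0, P u ∈ K.faces := fun u hu => by
    obtain ⟨i, hi⟩ := hw u hu
    exact mem_faces_of_inner_pos (u := u) ⟨i, by simpa [P] using hi⟩ (by simp [P])
  have hS : ∀ u : S, (u : EuclideanSpace ℝ (Fin k)) ≠ 0 := fun u => ne_zero_of_mem_unit_sphere u
  -- The map from the sphere sends `u` to the weights `max ⟪u, w i⟫ 0`, rescaled to total mass `1`.
  let p : EuclideanSpace ℝ (Fin k) → ι → ℝ := fun u i => max ⟪u, w i⟫_ℝ 0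
  have hpc : Continuous p := by fun_prop
  have hp0 : ∀ u i, 0 ≤ p u i := fun u i => le_max_right _ _
  have hp : ∀ u i, i ∉ P u → p u i = 0 := fun u i hi => by simpa [p, P] using hi
  have hppos : ∀ u ≠ 0, 0 < ∑ i, p u i := fun u hu => by
    obtain ⟨i, hi⟩ := hw u hu
    exact Finset.sum_pos' (fun i _ => hp0 u i) ⟨i, Finset.mem_univ i, lt_max_of_lt_left hi⟩
  have hsupp : ∀ (u : EuclideanSpace ℝ (Fin k)) (y : ι → ℝ) (c : ℝ),
      Function.support (c • fun i => y i * p u i) ⊆ (P u : Set ι) := fun u y c i hi => by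
    by_contra h
    exact hi (by simp [hp u i h])
  have hφc : Continuous fun u : S => p u := hpc.comp continuous_subtype_val
  let φ : C(S, realization K) :=
    ⟨fun u => ⟨(∑ i, p u i)⁻¹ • p u, inv_sum_smul_mem_stdSimplex (hp0 u) (hppos u (hS u)),
      P u, hP u (hS u), by simpa using hsupp u 1 (∑ i, p u i)⁻¹⟩,
      Continuous.subtype_mk (Continuous.smul (Continuous.inv₀
        (continuous_finsetSum _ fun i _ => (continuous_apply i).comp hφc)
        fun u => (hppos u (hS u)).ne') hφc) _⟩
  have hφ : ∀ u, Function.support (φ u : ι → ℝ) ⊆ (P u : Set ι) := fun u => by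
    simpa [φ] using hsupp u 1 (∑ i, p u i)⁻¹
  have hψc : Continuous fun x : realization K => L x := hLc.comp continuous_subtype_val
  have hψS : ∀ x : realization K, ‖L x‖⁻¹ • L x ∈ S := fun x => by
    rw [mem_sphere_zero_iff_norm, norm_smul, norm_inv, norm_norm,
      inv_mul_cancel₀ (norm_ne_zero_iff.2 (hL x))]
  let ψ : C(realization K, S) :=
    ⟨fun x => ⟨‖L x‖⁻¹ • L x, hψS x⟩,
      Continuous.subtype_mk ((hψc.norm.inv₀ fun x => norm_ne_zero_iff.2 (hL x)).smul hψc) hψS⟩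
  have hPψ : ∀ x, P (ψ x) = P (L x) := fun x => by
    ext i
    have : 0 < ‖L x‖⁻¹ := inv_pos.2 (norm_pos_iff.2 (hL x))
    simp [P, ψ, real_inner_smul_left, mul_pos_iff_of_pos_left this]
  -- The weights `x i * max ⟪L x, w i⟫ 0` are supported both in the support of `x` and in `P (L x)`,
  -- so the corresponding map links the identity to `φ ∘ ψ` through simplices of `K`. They do not
  -- all vanish because `∑ i, x i * ⟪L x, w i⟫ = ‖L x‖ ^ 2`.
  have hqpos : ∀ x : realization K, 0 < ∑ i, (x : ι → ℝ) i * p (L x) i := fun x => by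
    calc 0 < ⟪L x, L x⟫_ℝ := real_inner_self_pos.2 (hL x)
      _ = ∑ i, (x : ι → ℝ) i * ⟪L x, w i⟫_ℝ := by
        conv_lhs => rw [show L x = ∑ i, (x : ι → ℝ) i • w i from rfl, inner_sum]
        simp [real_inner_smul_right, L]
      _ ≤ ∑ i, (x : ι → ℝ) i * p (L x) i :=
        Finset.sum_le_sum fun i _ => mul_le_mul_of_nonneg_left (le_max_left _ _) (x.2.1.1 i)
  have hqc : Continuous fun (x : realization K) i => (x : ι → ℝ) i * p (L x) i :=
    continuous_pi fun i => ((continuous_apply i).comp continuous_subtype_val).mul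
      ((continuous_apply i).comp (hpc.comp (hLc.comp continuous_subtype_val)))
  let q : C(realization K, realization K) :=
    ⟨fun x => ⟨(∑ i, (x : ι → ℝ) i * p (L x) i)⁻¹ • fun i => (x : ι → ℝ) i * p (L x) i,
      inv_sum_smul_mem_stdSimplex (fun i => mul_nonneg (x.2.1.1 i) (hp0 _ i)) (hqpos x),
      P (L x), hP _ (hL x), hsupp _ _ _⟩,
      Continuous.subtype_mk (Continuous.smul (Continuous.inv₀
        (continuous_finsetSum _ fun i _ => (continuous_apply i).comp hqc)
        fun x => (hqpos x).ne') hqc) _⟩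
  refine ⟨⟨ψ, φ, ?_, ?_⟩⟩
  · refine (homotopic_of_common_simplex _ q fun x => ⟨P (L x), hP _ (hL x), ?_, ?_⟩).trans
      (homotopic_of_common_simplex q _ fun x => ?_)
    · rw [← hPψ]
      exact hφ (ψ x)
    · exact hsupp _ _ _
    · obtain ⟨s, hs, hxs⟩ := x.2.2
      refine ⟨s, hs, fun i hi => hxs fun h => hi ?_, hxs⟩
      simp [q, h]
  · refine homotopic_of_inner_pos _ _ fun u => ?_
    -- `⟪L (p u), u⟫ = ∑ i, p u i * ⟪u, w i⟫`, and each term equals `(p u i) ^ 2`.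
    have hmul : ∀ i, p u i * ⟪(u : EuclideanSpace ℝ (Fin k)), w i⟫_ℝ = p u i * p u i := fun i => by
      by_cases hi : i ∈ P u
      · have : 0 < ⟪(u : EuclideanSpace ℝ (Fin k)), w i⟫_ℝ := by simpa [P] using hi
        simp only [p, max_eq_left this.le]
      · simp [hp _ i hi]
    have hkey : 0 < ⟪L (φ u), (u : EuclideanSpace ℝ (Fin k))⟫_ℝ := by
      have : ⟪L (φ u), (u : EuclideanSpace ℝ (Fin k))⟫_ℝ =
          (∑ i, p u i)⁻¹ * ∑ i, p u i * p u i := by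
        simp only [L, φ, ContinuousMap.coe_mk, sum_inner, Pi.smul_apply, smul_eq_mul,
          real_inner_smul_left, Finset.mul_sum, mul_assoc]
        refine Finset.sum_congr rfl fun i _ => ?_
        rw [real_inner_comm, hmul]
      rw [this]
      obtain ⟨i, hi⟩ := hw u (hS u)
      have hi' : 0 < p u i := lt_max_of_lt_left hi
      exact mul_pos (inv_pos.2 (hppos u (hS u)))
        (Finset.sum_pos' (fun i _ => mul_self_nonneg _) ⟨i, Finset.mem_univ i, mul_pos hi' hi'⟩)
    have : 0 < ‖L (φ u)‖⁻¹ := inv_pos.2 (norm_pos_iff.2 (hL _))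
    simpa [ψ, real_inner_smul_left] using mul_pos this hkey

/-! ### Cones -/

theorem nonBalancedComplex_eq_join {d : ℕ} {ι : Type*} [Fintype ι] [DecidableEq ι]
    {v : ι → EuclideanSpace ℝ (Fin d)} {r : EuclideanSpace ℝ (Fin d)} {T : Finset ι}
    (hT : ∀ I, IsBalanced v r I → IsBalanced v r (I \ T)) :
    nonBalancedComplex v r = join (induced (nonBalancedComplex v r) Tᶜ) (fullSimplex T) := by
  ext I
  constructor
  · rintro ⟨hI, hIr⟩
    refine ⟨hI, I \ T, I ∩ T, ?_, ?_, (Finset.sdiff_union_inter I T).symm⟩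
    · refine (I \ T).eq_empty_or_nonempty.imp_right fun h => ⟨⟨h, fun hb => hIr ?_⟩, ?_⟩
      · exact convexHull_mono (Set.image_mono (Finset.coe_subset.2 Finset.sdiff_subset)) hb
      · exact fun i hi => Finset.mem_compl.2 (Finset.mem_sdiff.1 hi).2
    · exact (I ∩ T).eq_empty_or_nonempty.imp_right fun h => ⟨h, Finset.inter_subset_right⟩
  · rintro ⟨hI, a, b, ha, hb, rfl⟩
    refine ⟨hI, fun h => ?_⟩
    have hbT : b ⊆ T := by
      rcases hb with rfl | hb
      exacts [Finset.empty_subset _, hb.2]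
    have hsub : (a ∪ b) \ T ⊆ a := fun i hi => by
      rw [Finset.mem_sdiff, Finset.mem_union] at hi
      exact hi.1.resolve_right fun h => hi.2 (hbT h)
    have hbal : IsBalanced v r a :=
      convexHull_mono (Set.image_mono (Finset.coe_subset.2 hsub)) (hT _ h)
    rcases ha with rfl | ha
    · exact not_isBalanced_empty v r hbal
    · exact ha.1.2 hbal

/-- The realization of a cone is star-shaped about its apex. -/
theorem contractibleSpace_realization {ι : Type*} [Fintype ι] [DecidableEq ι]
    {K : PreAbstractSimplicialComplex ι} {t : ι} (ht : {t} ∈ K.faces)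
    (hK : ∀ s ∈ K.faces, insert t s ∈ K.faces) : ContractibleSpace (realization K) := by
  have hmem : (Pi.single t 1 : ι → ℝ) ∈ realization K :=
    ⟨single_mem_stdSimplex ℝ t, {t}, ht, by simp⟩
  refine StarConvex.contractibleSpace (x := Pi.single t 1) ?_ ⟨_, hmem⟩
  rintro y ⟨hy, s, hs, hys⟩ a b ha hb hab
  refine ⟨convex_stdSimplex ℝ ι hmem.1 hy ha hb hab, _, hK s hs, fun i hi => ?_⟩
  by_contra his
  rw [Finset.coe_insert, Set.mem_insert_iff, not_or] at his
  have h1 : y i = 0 := Function.notMem_support.1 fun h => his.2 (hys h)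
  exact hi (by simp [h1, his.1])

theorem contractibleSpace_and_exists_eq_join {d : ℕ} {ι : Type*} [Fintype ι] [DecidableEq ι]
    {v : ι → EuclideanSpace ℝ (Fin d)} {r : EuclideanSpace ℝ (Fin d)} {T : Finset ι}
    (hTne : T.Nonempty) (hT : ∀ I, IsBalanced v r I → IsBalanced v r (I \ T)) :
    ContractibleSpace (realization (nonBalancedComplex v r)) ∧
      ∃ T : Finset ι, T.Nonempty ∧ nonBalancedComplex v r =
        join (induced (nonBalancedComplex v r) Tᶜ) (fullSimplex T) := by
  refine ⟨?_, T, hTne, nonBalancedComplex_eq_join hT⟩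
  obtain ⟨t, ht⟩ := hTne
  refine contractibleSpace_realization (t := t) ⟨by simp, fun h => ?_⟩ fun s hs =>
    ⟨by simp, fun h => hs.2 ?_⟩
  · refine not_isBalanced_empty v r ?_
    simpa [Finset.sdiff_eq_empty_iff_subset.2 (Finset.singleton_subset_iff.2 ht)] using hT _ h
  · refine convexHull_mono (Set.image_mono (Finset.coe_subset.2 ?_)) (hT _ h)
    rw [Finset.insert_sdiff_of_mem _ ht]
    exact Finset.sdiff_subset

/-- If a hyperplane through the origin supports `conv(w)`, then the weights of a convex combination
of the `w i` equal to `0` vanish off the hyperplane. -/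
theorem isBalanced_sdiff_of_nonneg {d : ℕ} {ι : Type*} [Fintype ι] [DecidableEq ι]
    {w : ι → EuclideanSpace ℝ (Fin d)} (f : EuclideanSpace ℝ (Fin d) →ₗ[ℝ] ℝ)
    (hf : ∀ i, 0 ≤ f (w i)) {T : Finset ι} (hT : ∀ i ∈ T, 0 < f (w i)) {I : Finset ι}
    (hI : IsBalanced w 0 I) : IsBalanced w 0 (I \ T) := by
  obtain ⟨x, hx, hxI, hx0⟩ := isBalanced_iff.1 hI
  refine isBalanced_iff.2 ⟨x, hx, fun i hi => ?_, hx0⟩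
  have hsum : ∑ i, x i * f (w i) = 0 := by simpa using congrArg f hx0
  have hzero := (Finset.sum_eq_zero_iff_of_nonneg
    fun i _ => mul_nonneg (hx.1 i) (hf i)).1 hsum i (Finset.mem_univ i)
  refine Finset.mem_coe.2 (Finset.mem_sdiff.2 ⟨hxI hi, fun hiT => ?_⟩)
  exact (mul_ne_zero hi (hT i hiT).ne') hzero

/-! ### Position of the origin relative to a full-dimensional polytope -/

theorem exists_inner_pos_of_zero_mem_interior {k : ℕ} {ι : Type*}
    {w : ι → EuclideanSpace ℝ (Fin k)} (h0 : 0 ∈ interior (convexHull ℝ (Set.range w)))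
    {u : EuclideanSpace ℝ (Fin k)} (hu : u ≠ 0) : ∃ i, 0 < ⟪u, w i⟫_ℝ := by
  by_contra! hle
  have hsub : convexHull ℝ (Set.range w) ⊆ {y | innerSL ℝ u y ≤ 0} :=
    convexHull_min (by rintro _ ⟨i, rfl⟩; exact hle i)
      (convex_halfSpace_le (innerSL ℝ u).toLinearMap.isLinear 0)
  have hcont : Filter.Tendsto (fun t : ℝ => t • u) (nhdsWithin 0 (Set.Ioi 0)) (nhds 0) := by
    have : Continuous fun t : ℝ => t • u := by fun_prop
    simpa using (this.tendsto 0).mono_left nhdsWithin_le_nhds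
  obtain ⟨t, ht, htpos⟩ :=
    ((hcont.eventually (mem_interior_iff_mem_nhds.1 h0)).and self_mem_nhdsWithin).exists
  have h1 : ⟪u, t • u⟫_ℝ ≤ 0 := hsub ht
  rw [real_inner_smul_right] at h1
  exact h1.not_gt (mul_pos htpos (real_inner_self_pos.2 hu))

theorem exists_nonneg_of_zero_notMem_interior {k : ℕ} {ι : Type*}
    {w : ι → EuclideanSpace ℝ (Fin k)} (hspan : affineSpan ℝ (Set.range w) = ⊤)
    (h0 : 0 ∉ interior (convexHull ℝ (Set.range w))) :
    ∃ f : EuclideanSpace ℝ (Fin k) →ₗ[ℝ] ℝ, (∀ i, 0 ≤ f (w i)) ∧ ∃ i, 0 < f (w i) := by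
  have hconv := convex_convexHull ℝ (Set.range w)
  have hne : (interior (convexHull ℝ (Set.range w))).Nonempty :=
    hconv.interior_nonempty_iff_affineSpan_eq_top.2 (by rw [affineSpan_convexHull, hspan])
  obtain ⟨f, hf0, hf⟩ := geometric_hahn_banach_of_nonempty_interior_point hconv h0 hne
  have hle : ∀ i, f (w i) ≤ 0 := fun i => by
    simpa using hf _ (subset_convexHull ℝ _ (Set.mem_range_self i))
  refine ⟨-f.toLinearMap, fun i => by simpa using hle i, ?_⟩
  by_contra! hge
  -- A functional vanishing on all `w i` vanishes on their affine span, which is everything.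
  have hzero : f.toLinearMap.toAffineMap = (0 : EuclideanSpace ℝ (Fin k) →ₗ[ℝ] ℝ).toAffineMap := by
    refine AffineMap.ext_on hspan ?_
    rintro _ ⟨i, rfl⟩
    exact le_antisymm (hle i) (by simpa using hge i)
  exact hf0 (ContinuousLinearMap.ext fun x => DFunLike.congr_fun hzero x)

/-! ### Reduction to full dimension -/

/-- A point `r` of the affine span and the points `v i` come from the origin and a full-dimensional
family of points under an affine isometric embedding. -/
theorem exists_affineIsometry {d k : ℕ} {ι : Type*} {v : ι → EuclideanSpace ℝ (Fin d)}
    {r : EuclideanSpace ℝ (Fin d)} (hk : rk v = k) (hr : r ∈ affineSpan ℝ (Set.range v)) :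
    ∃ (φ : EuclideanSpace ℝ (Fin k) →ᵃⁱ[ℝ] EuclideanSpace ℝ (Fin d))
      (w : ι → EuclideanSpace ℝ (Fin k)),
      φ 0 = r ∧ (∀ i, φ (w i) = v i) ∧ affineSpan ℝ (Set.range w) = ⊤ := by
  set A := affineSpan ℝ (Set.range v)
  have hdim : Module.finrank ℝ A.direction = k := by
    rw [← hk, rk, ← direction_affineSpan, affineSpan_convexHull]
  have : Nonempty A := ⟨⟨r, hr⟩⟩
  let b := (stdOrthonormalBasis ℝ A.direction).reindex (finCongr hdim)
  let e : EuclideanSpace ℝ (Fin k) ≃ᵃⁱ[ℝ] A :=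
    b.repr.symm.toAffineIsometryEquiv.trans (AffineIsometryEquiv.vaddConst ℝ (⟨r, hr⟩ : A))
  let φ := A.subtypeₐᵢ.comp e.toAffineIsometry
  let w : ι → EuclideanSpace ℝ (Fin k) :=
    fun i => e.symm ⟨v i, subset_affineSpan ℝ _ (Set.mem_range_self i)⟩
  have hφw : ∀ i, φ (w i) = v i := fun i => by simp [φ, w]
  refine ⟨φ, w, by simp [φ, e], hφw, ?_⟩
  have hmap : (affineSpan ℝ (Set.range w)).map φ.toAffineMap = A := by
    rw [AffineSubspace.map_span, ← Set.range_comp]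
    exact congrArg (fun g => affineSpan ℝ (Set.range g)) (funext hφw)
  refine eq_top_iff.2 fun x _ => ?_
  have hx : φ x ∈ (affineSpan ℝ (Set.range w)).map φ.toAffineMap := by
    rw [hmap]
    exact (e x).2
  obtain ⟨y, hy, hyx⟩ := hx
  rwa [← φ.injective hyx]

theorem intrinsicInterior_eq_interior {V : Type*} [NormedAddCommGroup V] [NormedSpace ℝ V]
    {s : Set V} (hs : affineSpan ℝ s = ⊤) : intrinsicInterior ℝ s = interior s := by
  refine Set.Subset.antisymm ?_ interior_subset_intrinsicInterior
  have hopen : IsOpen (affineSpan ℝ s : Set V) := by simp [hs]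
  refine interior_maximal intrinsicInterior_subset ?_
  exact hopen.isOpenMap_subtype_val _ isOpen_interior

end BalancedPairs

open BalancedPairs in
theorem theorem3p4 {d m k : ℕ} (hm : 0 < m) (v : Fin m → EuclideanSpace ℝ (Fin d))
    (r : EuclideanSpace ℝ (Fin d)) (hk : BalancedPairs.rk v = k) :
    (r ∈ intrinsicInterior ℝ (convexHull ℝ (Set.range v)) →
      Nonempty (ContinuousMap.HomotopyEquiv
        (BalancedPairs.realization (BalancedPairs.nonBalancedComplex v r))
        (Metric.sphere (0 : EuclideanSpace ℝ (Fin k)) 1))) ∧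
    (r ∉ intrinsicInterior ℝ (convexHull ℝ (Set.range v)) →
      ContractibleSpace (BalancedPairs.realization (BalancedPairs.nonBalancedComplex v r)) ∧
      ∃ T : Finset (Fin m), T.Nonempty ∧
        BalancedPairs.nonBalancedComplex v r =
          BalancedPairs.join
            (BalancedPairs.induced (BalancedPairs.nonBalancedComplex v r) Tᶜ)
            (BalancedPairs.fullSimplex T)) := by
  by_cases hr : r ∈ affineSpan ℝ (Set.range v)
  · obtain ⟨φ, w, rfl, hw, hspan⟩ := exists_affineIsometry hk hr
    obtain rfl : v = φ ∘ w := (funext hw).symm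
    have himage : ∀ s, convexHull ℝ (φ '' s) = φ '' convexHull ℝ s :=
      fun s => (φ.toAffineMap.image_convexHull s).symm
    have hK : nonBalancedComplex (φ ∘ w) (φ 0) = nonBalancedComplex w 0 := by
      ext I
      refine and_congr_right fun _ => not_congr ?_
      rw [IsBalanced, IsBalanced, Set.image_comp, himage, φ.injective.mem_set_image]
    have hint : φ 0 ∈ intrinsicInterior ℝ (convexHull ℝ (Set.range (φ ∘ w))) ↔
        0 ∈ interior (convexHull ℝ (Set.range w)) := by
      rw [Set.range_comp, himage, AffineIsometry.intrinsicInterior_image,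
        φ.injective.mem_set_image, intrinsicInterior_eq_interior]
      rw [affineSpan_convexHull, hspan]
    rw [hK, hint]
    refine ⟨fun h0 => nonempty_homotopyEquiv_sphere w fun u hu =>
      exists_inner_pos_of_zero_mem_interior h0 hu, fun h0 => ?_⟩
    obtain ⟨f, hf, i, hi⟩ := exists_nonneg_of_zero_notMem_interior hspan h0
    exact contractibleSpace_and_exists_eq_join (T := {i | 0 < f (w i)}) ⟨i, by simpa using hi⟩
      fun I => isBalanced_sdiff_of_nonneg f hf (by simp)
  · have hconv : r ∉ convexHull ℝ (Set.range v) :=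
      fun h => hr (convexHull_subset_affineSpan _ h)
    refine ⟨fun h => (hconv (intrinsicInterior_subset h)).elim, fun _ => ?_⟩
    have : Nonempty (Fin m) := ⟨⟨0, hm⟩⟩
    exact contractibleSpace_and_exists_eq_join Finset.univ_nonempty fun I hI =>
      (hconv (convexHull_mono (Set.image_subset_range _ _) hI)).elim
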